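/- Let $p,q\ge 0$ be integers with $n=p+q$ odd, let $\eta=(\eta^{ab})=\mathrm{diag}(1,\dots,1,-1,\dots,-1)$ with $p$ entries $+1$ followed by $q$ entries $-1$, and let $\mathcal{C}\ell^{\mathbb C}(p,q)$ be the complex Clifford algebra with identity $e$ and generators $e^1,\dots,e^n$ satisfying $e^ae^b+e^be^a=2\eta^{ab}e$. For a family $\gamma^1,\dots,\gamma^n$ of elements and a multi-index $A=\{a_1<\dots<a_k\}\subseteq\{1,\dots,n\}$ write $|A|=k$, $\gamma^A=\gamma^{a_1}\cdots\gamma^{a_k}$ (with $\gamma^{\varnothing}=e$), $\gamma_A=(\gamma^A)^{-1}$, $\gamma^{1\dots n}=\gamma^1\cdots\gamma^n$, $\gamma_{1\dots n}=(\gamma^{1\dots n})^{-1}$, and $e^{1\dots n}=e^1\cdots e^n$. The family is said to generate a basis if the $2^n$ elements $\gamma^A$ form a basis of $\mathcal{C}\ell^{\mathbb C}(p,q)$. Suppose that $\gamma^a,\beta^a\in\mathcal{C}\ell^{\mathbb C}(p,q)$, $a=1,\dots,n$, satisfy $$\gamma^a\gamma^b+\gamma^b\gamma^a=2\eta^{ab}e,\qquad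 \beta^a\beta^b+\beta^b\beta^a=2\eta^{ab}e\qquad\text{for all } a,b.$$ Consider the six cases with factors $c_1=e$, $c_2=-e$, $c_3=e^{1\dots n}$, $c_4=-e^{1\dots n}$, $c_5=ie^{1\dots n}$, $c_6=-ie^{1\dots n}$, where case $k$ means that $\beta^{1\dots n}=c_k\gamma^{1\dots n}$. Then: (i) If $p-q\equiv1\pmod 4$, then each of the two families either has top product ($\gamma^{1\dots n}$, respectively $\beta^{1\dots n}$) equal to $\pm e^{1\dots n}$ and generates a basis, or has top product equal to $\pm e$ and does not generate a basis; moreover one of the cases 1, 2, 3, 4 holds. (ii) If $p-q\equiv3\pmod 4$, then each of the two families either has top product equal to $\pm e^{1\dots n}$ and generates a basis, or has top product equal to $\pm ie$ and does not generate a basis; moreover one of the cases 1, 2, 5, 6 holds. (iii) Exactly one of the six cases holds. (iv) For each $k=1,\dots,6$, there exists an invertible element $T$ such that $$\gamma^a=c_k\,T^{-1}\beta^aT\quad\text{for all } a=1,\dots,n$$ if and only if $\beta^{1\dots n}=c_k\gamma^{1\dots n}$. If $T$ is such an element, then the set of all such elements is $\{zT\}$, where $z$ runs over the invertible elements of the center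 of $\mathcal{C}\ell^{\mathbb C}(p,q)$. (v) An invertible $T$ satisfies one of the six relations in (iv) if and only if $\gamma^a=(\beta^{1\dots n}\gamma_{1\dots n})\,T^{-1}\beta^aT$ for all $a=1,\dots,n$. (vi) For each $k$ with $\beta^{1\dots n}=c_k\gamma^{1\dots n}$, there are multi-indices $A,B$ with $|A|,|B|$ even (possibly $A=B$) such that, with $U=\gamma^A+\gamma^B$, the element $$T=H_{\mathrm{Even}}(U)=\frac1{2^{n-1}}\sum_{|C|\ \text{even}}\beta^C\,U\,\gamma_C$$ is invertible and satisfies $\gamma^a=c_k\,T^{-1}\beta^aT$ for all $a=1,\dots,n$. -/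

import Mathlib

namespace PauliClifford

noncomputable section

/-- The diagonal entries of `η`: the first `p` are `+1`, the remaining `q` are `-1`. -/
def sig (p q : ℕ) (a : Fin (p + q)) : ℂ := if (a : ℕ) < p then 1 else -1

/-- The matrix `η = diag(1, …, 1, -1, …, -1)`. -/
def eta (p q : ℕ) : Matrix (Fin (p + q)) (Fin (p + q)) ℂ := Matrix.diagonal (sig p q)

/-- The quadratic form `∑ a, η^{aa} x_a ^ 2` on `ℂ ^ (p + q)`. -/
def form (p q : ℕ) : QuadraticForm ℂ (Fin (p + q) → ℂ) :=
  QuadraticMap.weightedSumSquares ℂ (sig p q)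

/-- The complex Clifford algebra of signature `(p, q)`. -/
abbrev Cl (p q : ℕ) : Type := CliffordAlgebra (form p q)

/-- The fixed generators `e^a`. -/
def gen (p q : ℕ) (a : Fin (p + q)) : Cl p q := CliffordAlgebra.ι (form p q) (Pi.single a 1)

/-- For `A = {a₁ < ⋯ < a_k}`, the product `γ^A = γ^{a₁} ⋯ γ^{a_k}` (and `γ^∅ = 1`). -/
def mprod {M : Type*} [Monoid M] {n : ℕ} (γ : Fin n → M) (A : Finset (Fin n)) : M :=
  ((A.sort (· ≤ ·)).map γ).prod

/-- The product `γ^{1…n} = γ^1 ⋯ γ^n` of the whole family. -/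
def top {M : Type*} [Monoid M] {n : ℕ} (γ : Fin n → M) : M := mprod γ Finset.univ

/-- The element `e^{1…n}`. -/
def vol (p q : ℕ) : Cl p q := top (gen p q)

/-- The relations `γ^a γ^b + γ^b γ^a = 2 η^{ab} e`. -/
def Anticommutes {p q : ℕ} (γ : Fin (p + q) → Cl p q) : Prop :=
  ∀ a b, γ a * γ b + γ b * γ a = (2 * eta p q a b) • (1 : Cl p q)

/-- The `2 ^ n` products `γ^A` form a basis of the Clifford algebra. -/
def GeneratesBasis {p q : ℕ} (γ : Fin (p + q) → Cl p q) : Prop :=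
  LinearIndependent ℂ (mprod γ) ∧ Submodule.span ℂ (Set.range (mprod γ)) = ⊤

/-- `H_Even(U) = 2^{-(n-1)} ∑_{|A| even} β^A U γ_A`, where `γ_A = (γ^A)⁻¹`. -/
def HEven {p q : ℕ} (β γ : Fin (p + q) → Cl p q) (U : Cl p q) : Cl p q :=
  ((2 : ℂ) ^ (p + q - 1))⁻¹ •
    ∑ A : Finset (Fin (p + q)) with Even A.card, mprod β A * U * Ring.inverse (mprod γ A)

/-- The relation `γ^a = c T⁻¹ β^a T` for all `a`. -/
def Rel {p q : ℕ} (β γ : Fin (p + q) → Cl p q) (c : Cl p q) (T : (Cl p q)ˣ) : Prop :=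
  ∀ a, γ a = c * ((↑T⁻¹ : Cl p q) * β a * (T : Cl p q))

/-- The factors `1, -1, e^{1…n}, -e^{1…n}, i e^{1…n}, -i e^{1…n}` of the six cases, in this order
(numbered from `0`). -/
def factor (p q : ℕ) : Fin 6 → Cl p q :=
  ![1, -1, vol p q, -vol p q, Complex.I • vol p q, -(Complex.I • vol p q)]

end

end PauliClifford

/-!
For odd `n` only the even products `γ^B` matter. The average `H_Even(U)` always intertwines the
even products of `γ` with those of `β`, and for `β = γ` it annihilates `γ^B` for every nonempty
even `B`, because some even `γ^D` anticommutes with it. Hence every element is uniquely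
`∑_{|B| even} T_B γ^B` with even intertwiners `T_B`. Counting dimensions, the even intertwiners from
`γ` to itself form a plane, which is the center, spanned by `1` and `e^{1…n}`.

Therefore `γ^{1…n}` and `β^{1…n} γ_{1…n}` are central with known squares, which leaves only four
possible values for each. An even intertwiner `T` satisfies `γ^a = c T⁻¹ β^a T` precisely when
`β^{1…n} = c γ^{1…n}`: `γ^a` is a scalar multiple of `γ^{1…n}` times an even product, and the
scalar is the same for both families. To make `T` invertible, split `1` into the central idempotents
of the two simple blocks: in each block some `H_Even(γ^B)` is nonzero, a nonzero intertwiner is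
invertible there, and the sum of two such products (possibly equal) works in both blocks at once.
-/

namespace PauliClifford

open Finset
open scoped symmDiff Ring

section EvenSubsets

variable {α : Type*}

lemma even_card_symmDiff_iff [DecidableEq α] (A B : Finset α) :
    Even #(A ∆ B) ↔ (Even #A ↔ Even #B) := by
  have hcard : #(A ∆ B) = #(A \ B) + #(B \ A) := card_union_of_disjoint disjoint_sdiff_sdiff
  have hA := card_sdiff_add_card_inter A B
  have hB := card_sdiff_add_card_inter B A
  rw [inter_comm] at hB
  grind

lemma even_card_pair [DecidableEq α] {a b : α} (hab : a ≠ b) : Even #{a, b} := by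
  rw [card_pair hab]
  exact even_two

lemma sum_even_card_symmDiff [DecidableEq α] [Fintype α] {M : Type*} [AddCommMonoid M]
    {D : Finset α} (hD : Even #D) (f : Finset α → M) :
    ∑ A with Even #A, f (D ∆ A) = ∑ A with Even #A, f A :=
  sum_nbij' (D ∆ ·) (D ∆ ·) (by simp [even_card_symmDiff_iff, hD])
    (by simp [even_card_symmDiff_iff, hD]) (by simp) (by simp) (by simp)

lemma card_filter_even_card [Fintype α] [Nonempty α] :
    #{A : Finset α | Even #A} = 2 ^ (Fintype.card α - 1) := by
  have hsum : ∑ A : Finset α, (1 + (-1) ^ #A) = (2 * #{A : Finset α | Even #A} : ℤ) := by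
    have hterm (A : Finset α) : 1 + (-1 : ℤ) ^ #A = if Even #A then 2 else 0 := by
      split_ifs with h
      · rw [h.neg_one_pow]; rfl
      · rw [(Nat.not_even_iff_odd.1 h).neg_one_pow]; rfl
    simp only [hterm, ← sum_filter, sum_const, nsmul_eq_mul, mul_comm]
  have halt := sum_powerset_neg_one_pow_card_of_nonempty (univ_nonempty (α := α))
  rw [powerset_univ] at halt
  have hpow : 2 ^ Fintype.card α = 2 * 2 ^ (Fintype.card α - 1) := by
    rw [← pow_succ', Nat.sub_add_cancel Fintype.card_pos]
  rw [sum_add_distrib, halt, sum_const, card_univ, Fintype.card_finset, hpow] at hsum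
  simp only [nsmul_eq_mul, mul_one, add_zero, Nat.cast_mul, Nat.cast_ofNat] at hsum
  exact_mod_cast (mul_left_cancel₀ two_ne_zero hsum).symm

end EvenSubsets

section Products

variable {M : Type*} [Monoid M] {n : ℕ}

@[simp] lemma mprod_empty (γ : Fin n → M) : mprod γ ∅ = 1 := by
  simp [mprod]

lemma mprod_insert_of_forall_lt (γ : Fin n → M) {a : Fin n} {A : Finset (Fin n)}
    (ha : ∀ b ∈ A, a < b) : mprod γ (insert a A) = γ a * mprod γ A := by
  rw [mprod, sort_insert _ (fun b hb => (ha b hb).le) fun h => (ha a h).false]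
  simp [mprod]

@[simp] lemma mprod_singleton (γ : Fin n → M) (a : Fin n) : mprod γ {a} = γ a := by
  simp [mprod]

lemma semiconjBy_mprod {t : M} {β γ : Fin n → M} (h : ∀ a, SemiconjBy t (γ a) (β a))
    (A : Finset (Fin n)) : SemiconjBy t (mprod γ A) (mprod β A) := by
  induction A using Finset.induction_on_min with
  | empty => simp
  | insert a A ha ih =>
    rw [mprod_insert_of_forall_lt γ ha, mprod_insert_of_forall_lt β ha]
    exact (h a).mul_right ih

lemma mprod_smul {R : Type*} [CommMonoid R] [MulAction R M] [IsScalarTower R M M]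
    [SMulCommClass R M M] (r : Fin n → R) (γ : Fin n → M) (A : Finset (Fin n)) :
    mprod (fun a => r a • γ a) A = (∏ a ∈ A, r a) • mprod γ A := by
  induction A using Finset.induction_on_min with
  | empty => simp
  | insert a A ha ih =>
    rw [mprod_insert_of_forall_lt _ ha, mprod_insert_of_forall_lt _ ha, ih, smul_mul_smul_comm,
      prod_insert fun h => (ha a h).false]

lemma mprod_const_mul {c : M} (hc : c ∈ Submonoid.center M) (γ : Fin n → M)
    (A : Finset (Fin n)) : mprod (fun a => c * γ a) A = c ^ #A * mprod γ A := by
  simpa [Submonoid.smul_def] using mprod_smul (fun _ => (⟨c, hc⟩ : Submonoid.center M)) γ A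

end Products

/-- A family in a `K`-algebra satisfying the Clifford relations for a diagonal form. The weights
`s a` are units so that products of the `γ a` have structure constants in `Kˣ`. -/
structure IsCliffordFamily {K A : Type*} [CommRing K] [Ring A] [Algebra K A] {n : ℕ}
    (s : Fin n → Kˣ) (γ : Fin n → A) : Prop where
  mul_self (a : Fin n) : γ a * γ a = s a • 1
  mul_eq_neg {a b : Fin n} (hab : a ≠ b) : γ a * γ b = -(γ b * γ a)

section Clifford

variable {K A : Type*} [CommRing K] [Ring A] [Algebra K A] {n : ℕ} {s : Fin n → Kˣ}
  {γ : Fin n → A}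

lemma exists_mul_mprod (s : Fin n → Kˣ) (a : Fin n) (B : Finset (Fin n)) :
    ∃ c : Kˣ, ∀ γ : Fin n → A, IsCliffordFamily s γ → γ a * mprod γ B = c • mprod γ ({a} ∆ B) := by
  induction B using Finset.induction_on_min with
  | empty =>
    have hset : ({a} : Finset (Fin n)) ∆ ∅ = {a} := symmDiff_bot _
    exact ⟨1, fun γ _ => by simp [hset]⟩
  | insert b B hb ih =>
    rcases lt_trichotomy a b with hab | rfl | hba
    · have hlt : ∀ d ∈ insert b B, a < d := by grind
      have hset : {a} ∆ insert b B = insert a (insert b B) := by grind [mem_symmDiff]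
      exact ⟨1, fun γ _ => by rw [hset, mprod_insert_of_forall_lt γ hlt, one_smul]⟩
    · have hset : {a} ∆ insert a B = B := by grind [mem_symmDiff]
      exact ⟨s a, fun γ hγ => by
        rw [hset, mprod_insert_of_forall_lt γ hb, ← mul_assoc, hγ.mul_self, smul_one_mul]⟩
    · obtain ⟨c, hc⟩ := ih
      have hset : {a} ∆ insert b B = insert b ({a} ∆ B) := by grind [mem_symmDiff]
      have hlt : ∀ d ∈ {a} ∆ B, b < d := by grind [mem_symmDiff]
      refine ⟨-c, fun γ hγ => ?_⟩
      rw [hset, mprod_insert_of_forall_lt γ hb, mprod_insert_of_forall_lt γ hlt, ← mul_assoc,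
        hγ.mul_eq_neg hba.ne', neg_mul, mul_assoc, hc γ hγ, mul_smul_comm, Units.neg_smul]

lemma exists_mprod_mul_mprod (s : Fin n → Kˣ) (B C : Finset (Fin n)) :
    ∃ c : Kˣ, ∀ γ : Fin n → A, IsCliffordFamily s γ →
      mprod γ B * mprod γ C = c • mprod γ (B ∆ C) := by
  induction B using Finset.induction_on_min with
  | empty => exact ⟨1, fun γ _ => by simp [show ∅ ∆ C = C from bot_symmDiff C]⟩
  | insert b B hb ih =>
    obtain ⟨c, hc⟩ := ih
    obtain ⟨d, hd⟩ := exists_mul_mprod (A := A) s b (B ∆ C)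
    have hset : insert b B ∆ C = {b} ∆ (B ∆ C) := by
      grind [mem_symmDiff]
    refine ⟨c * d, fun γ hγ => ?_⟩
    rw [hset, mprod_insert_of_forall_lt γ hb, mul_assoc, hc γ hγ, mul_smul_comm, hd γ hγ,
      mul_smul]

namespace IsCliffordFamily

lemma semiconjBy (h : IsCliffordFamily s γ) (a : Fin n) (B : Finset (Fin n)) :
    SemiconjBy (γ a) (mprod γ B) ((-1) ^ #(B.erase a) * mprod γ B) := by
  have hsign (b : Fin n) : SemiconjBy (γ a) (γ b) ((if b = a then 1 else -1 : ℤ) • γ b) := by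
    split_ifs with hb
    · rw [hb, one_smul]; exact Commute.refl (γ a)
    · rw [neg_one_smul, SemiconjBy, neg_mul, h.mul_eq_neg (Ne.symm hb)]
  have hprod : ∏ b ∈ B, (if b = a then 1 else -1 : ℤ) = (-1) ^ #(B.erase a) := by
    rw [prod_ite, prod_const_one, one_mul, prod_const, filter_ne' B a]
  have hsemi := semiconjBy_mprod hsign B
  rw [mprod_smul, hprod, zsmul_eq_mul] at hsemi
  exact_mod_cast hsemi

lemma commute_top (h : IsCliffordFamily s γ) (hn : Odd n) (a : Fin n) :
    Commute (γ a) (top γ) := by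
  have heven : Even #(univ.erase a) := by
    rw [card_erase_of_mem (mem_univ a), card_univ, Fintype.card_fin]
    exact hn.tsub_odd odd_one
  have hsemi := h.semiconjBy a univ
  rwa [heven.neg_one_pow, one_mul] at hsemi

lemma mprod_mul_self (h : IsCliffordFamily s γ) (B : Finset (Fin n)) :
    mprod γ B * mprod γ B = ((-1) ^ (#B).choose 2 * ∏ b ∈ B, s b) • (1 : A) := by
  induction B using Finset.induction_on_min with
  | empty => simp
  | insert b B hb ih =>
    have hbB : b ∉ B := fun h => (hb b h).false
    have hcomm : mprod γ B * γ b = (-1 : Kˣ) ^ #B • (γ b * mprod γ B) := by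
      have := (h.semiconjBy b B).eq
      rw [erase_eq_of_notMem hbB] at this
      rw [this]
      rcases Nat.even_or_odd #B with hB | hB <;> simp [hB.neg_one_pow, Units.neg_smul]
    calc mprod γ (insert b B) * mprod γ (insert b B)
        = γ b * (mprod γ B * γ b) * mprod γ B := by
          rw [mprod_insert_of_forall_lt γ hb]; simp only [mul_assoc]
      _ = (-1 : Kˣ) ^ #B • (γ b * γ b * (mprod γ B * mprod γ B)) := by
          rw [hcomm, mul_smul_comm, smul_mul_assoc]; simp only [mul_assoc]
      _ = _ := by
          rw [h.mul_self, ih, smul_mul_smul_comm, one_mul, smul_smul, card_insert_of_notMem hbB,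
            prod_insert hbB, Nat.choose_succ_succ' _ 1, Nat.choose_one_right, pow_add]
          congr 1
          ac_rfl

lemma isUnit_mprod (h : IsCliffordFamily s γ) (B : Finset (Fin n)) : IsUnit (mprod γ B) := by
  have hunit : IsUnit (mprod γ B * mprod γ B) := by
    rw [h.mprod_mul_self]
    exact isUnit_one.smul _
  exact ((Commute.refl _).isUnit_mul_iff.1 hunit).1

lemma inverse_mprod (h : IsCliffordFamily s γ) (B : Finset (Fin n)) :
    (mprod γ B)⁻¹ʳ = ((-1) ^ (#B).choose 2 * ∏ b ∈ B, s b)⁻¹ • mprod γ B := by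
  refine (h.isUnit_mprod B).mul_left_cancel ?_
  rw [Ring.mul_inverse_cancel _ (h.isUnit_mprod B), mul_smul_comm, h.mprod_mul_self,
    inv_smul_smul]

end IsCliffordFamily

lemma conj_conj {β : Fin n → A} (hβ : IsCliffordFamily s β) (hγ : IsCliffordFamily s γ)
    (D B : Finset (Fin n)) (U : A) :
    mprod β D * (mprod β B * U * (mprod γ B)⁻¹ʳ) * (mprod γ D)⁻¹ʳ =
      mprod β (D ∆ B) * U * (mprod γ (D ∆ B))⁻¹ʳ := by
  obtain ⟨c, hc⟩ := exists_mprod_mul_mprod (A := A) s D B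
  have hinv : c • ((mprod γ B)⁻¹ʳ * (mprod γ D)⁻¹ʳ) = (mprod γ (D ∆ B))⁻¹ʳ := by
    refine (hγ.isUnit_mprod (D ∆ B)).mul_left_cancel ?_
    rw [mul_smul_comm, ← smul_mul_assoc, ← hc γ hγ, Ring.mul_inverse_cancel _ (hγ.isUnit_mprod _),
      ← mul_assoc, mul_assoc (mprod γ D), Ring.mul_inverse_cancel _ (hγ.isUnit_mprod _), mul_one,
      Ring.mul_inverse_cancel _ (hγ.isUnit_mprod _)]
  calc _ = mprod β D * mprod β B * U * ((mprod γ B)⁻¹ʳ * (mprod γ D)⁻¹ʳ) := by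
        simp only [mul_assoc]
    _ = _ := by
        rw [hc β hβ, smul_mul_assoc, smul_mul_assoc, ← mul_smul_comm, hinv]

lemma IsCliffordFamily.exists_semiconjBy_neg (h : IsCliffordFamily s γ) (hn : Odd n)
    {C : Finset (Fin n)} (hC : Even #C) (hne : C.Nonempty) :
    ∃ D : Finset (Fin n), Even #D ∧ SemiconjBy (mprod γ D) (mprod γ C) (-mprod γ C) := by
  obtain ⟨a, ha⟩ := hne
  obtain ⟨b, hb⟩ : ∃ b, b ∉ C := by
    by_contra! hall
    rw [eq_univ_of_forall hall, card_univ, Fintype.card_fin] at hC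
    exact Nat.not_even_iff_odd.2 hn hC
  have hab : a ≠ b := by rintro rfl; exact hb ha
  have hsa : SemiconjBy (γ a) (mprod γ C) (-mprod γ C) := by
    have hodd : Odd #(C.erase a) := by
      rw [card_erase_of_mem ha]
      exact Nat.Even.sub_odd (card_pos.2 ⟨a, ha⟩) hC odd_one
    simpa [hodd.neg_one_pow] using h.semiconjBy a C
  have hsb : SemiconjBy (γ b) (mprod γ C) (mprod γ C) := by
    simpa [erase_eq_of_notMem hb, hC.neg_one_pow] using h.semiconjBy b C
  obtain ⟨c, hc⟩ := exists_mul_mprod (A := A) s a {b}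
  have hset : ({a} : Finset (Fin n)) ∆ {b} = {a, b} := by grind [mem_symmDiff]
  have hpair : mprod γ {a, b} = c⁻¹ • (γ a * γ b) := by
    rw [eq_inv_smul_iff, ← hset, ← hc γ h, mprod_singleton]
  refine ⟨{a, b}, even_card_pair hab, ?_⟩
  rw [hpair, SemiconjBy, smul_mul_assoc, mul_smul_comm, (hsa.mul_left hsb).eq]

end Clifford

section Averaging

variable {A : Type*} [Ring A] {n : ℕ}

/-- The elements `T` with `T γ^B = β^B T` for every even multi-index `B`; for odd `n` this is
where the invertible intertwiners between `γ` and any central multiple of `β` live. -/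
def evenIntertwiners (K : Type*) [CommRing K] [Algebra K A] (β γ : Fin n → A) :
    Submodule K A where
  carrier := {T | ∀ B : Finset (Fin n), Even #B → SemiconjBy T (mprod γ B) (mprod β B)}
  add_mem' hS hT B hB := (hS B hB).add_left (hT B hB)
  zero_mem' _ _ := SemiconjBy.zero_left _ _
  smul_mem' c T hT B hB := by
    rw [SemiconjBy, smul_mul_assoc, mul_smul_comm, (hT B hB).eq]

/-- The linear map `U ↦ 2^{-(n-1)} ∑_{|B| even} β^B U γ_B`, that is `HEven` over any field. -/
noncomputable def evenAverage (K : Type*) [Field K] [Algebra K A] (β γ : Fin n → A) :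
    A →ₗ[K] A :=
  ((2 : K) ^ (n - 1))⁻¹ • ∑ B with Even #B, LinearMap.mulLeftRight K (mprod β B, (mprod γ B)⁻¹ʳ)

section Intertwiners

variable {K : Type*} [CommRing K] [Algebra K A] {δ β γ : Fin n → A}

lemma mul_mem_evenIntertwiners {S T : A} (hS : S ∈ evenIntertwiners K δ β)
    (hT : T ∈ evenIntertwiners K β γ) : S * T ∈ evenIntertwiners K δ γ :=
  fun B hB => (hS B hB).mul_left (hT B hB)

lemma units_inv_mem_evenIntertwiners {T : Aˣ} (hT : (T : A) ∈ evenIntertwiners K β γ) :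
    ((T⁻¹ : Aˣ) : A) ∈ evenIntertwiners K γ β :=
  fun B hB => (hT B hB).units_inv_symm_left

lemma center_le_evenIntertwiners :
    (Subalgebra.center K A).toSubmodule ≤ evenIntertwiners K γ γ :=
  fun _ hz B _ => (Subalgebra.mem_center_iff (R := K).1 hz (mprod γ B)).symm

end Intertwiners

variable {K : Type*} [Field K] [Algebra K A] {s : Fin n → Kˣ} {δ β γ : Fin n → A}

lemma evenAverage_apply (U : A) : evenAverage K β γ U =
    ((2 : K) ^ (n - 1))⁻¹ • ∑ B with Even #B, mprod β B * U * (mprod γ B)⁻¹ʳ := by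
  simp [evenAverage]

lemma evenAverage_mul {T : A} (hT : T ∈ evenIntertwiners K δ β) (U : A) :
    evenAverage K δ γ (T * U) = T * evenAverage K β γ U := by
  simp only [evenAverage_apply, mul_smul_comm, mul_sum]
  congr 1
  refine sum_congr rfl fun B hB => ?_
  simp only [← mul_assoc, (hT B (mem_filter_univ B |>.1 hB)).eq]

lemma evenAverage_conj (hβ : IsCliffordFamily s β) (hγ : IsCliffordFamily s γ)
    {D : Finset (Fin n)} (hD : Even #D) (U : A) :
    evenAverage K β γ (mprod β D * U * (mprod γ D)⁻¹ʳ) = evenAverage K β γ U := by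
  simp only [evenAverage_apply, conj_conj hβ hγ, symmDiff_comm _ D]
  rw [sum_even_card_symmDiff hD fun B => mprod β B * U * (mprod γ B)⁻¹ʳ]

lemma evenAverage_mem (hβ : IsCliffordFamily s β) (hγ : IsCliffordFamily s γ) (U : A) :
    evenAverage K β γ U ∈ evenIntertwiners K β γ := by
  intro D hD
  have hconj : mprod β D * evenAverage K β γ U * (mprod γ D)⁻¹ʳ = evenAverage K β γ U := by
    simp only [evenAverage_apply, mul_smul_comm, smul_mul_assoc, mul_sum, sum_mul,
      conj_conj hβ hγ]
    rw [sum_even_card_symmDiff hD fun B => mprod β B * U * (mprod γ B)⁻¹ʳ]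
  rw [SemiconjBy]
  nth_rw 1 [← hconj]
  rw [mul_assoc, Ring.inverse_mul_cancel _ (hγ.isUnit_mprod D), mul_one]

variable [NeZero (2 : K)]

lemma evenAverage_one (hγ : IsCliffordFamily s γ) (hn : 0 < n) : evenAverage K γ γ 1 = 1 := by
  have : Nonempty (Fin n) := ⟨⟨0, hn⟩⟩
  simp only [evenAverage_apply, mul_one, Ring.mul_inverse_cancel _ (hγ.isUnit_mprod _)]
  rw [sum_const, card_filter_even_card, Fintype.card_fin, ← Nat.cast_smul_eq_nsmul K,
    Nat.cast_pow, Nat.cast_ofNat, inv_smul_smul₀ (pow_ne_zero _ two_ne_zero)]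

lemma evenAverage_mprod_eq_zero (hγ : IsCliffordFamily s γ) (hn : Odd n) {C : Finset (Fin n)}
    (hC : Even #C) (hne : C.Nonempty) : evenAverage K γ γ (mprod γ C) = 0 := by
  obtain ⟨D, hD, hneg⟩ := hγ.exists_semiconjBy_neg hn hC hne
  have hself := evenAverage_conj (K := K) hγ hγ hD (mprod γ C)
  rw [hneg.eq, mul_assoc, Ring.mul_inverse_cancel _ (hγ.isUnit_mprod D), mul_one, map_neg,
    neg_eq_iff_add_eq_zero, ← two_smul K] at hself
  exact (smul_eq_zero.1 hself).resolve_left two_ne_zero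

lemma evenAverage_mprod_mul_inverse (hγ : IsCliffordFamily s γ) (hn : Odd n)
    {C B : Finset (Fin n)} (hC : Even #C) (hB : Even #B) :
    evenAverage K γ γ (mprod γ C * (mprod γ B)⁻¹ʳ) = if C = B then 1 else 0 := by
  split_ifs with h
  · rw [h, Ring.mul_inverse_cancel _ (hγ.isUnit_mprod B), evenAverage_one hγ hn.pos]
  · obtain ⟨c, hc⟩ := exists_mprod_mul_mprod (A := A) s C B
    have hne : (C ∆ B).Nonempty := nonempty_iff_ne_empty.2 fun h0 => h (symmDiff_eq_bot.1 h0)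
    have heven : Even #(C ∆ B) := by simp [even_card_symmDiff_iff, hC, hB]
    simp [hγ.inverse_mprod B, hc γ hγ, Units.smul_def, evenAverage_mprod_eq_zero hγ hn heven hne]

lemma sum_evenAverage_mul_mprod (hγ : IsCliffordFamily s γ) (hn : Odd n) (U : A) :
    ∑ B with Even #B, evenAverage K β γ (U * (mprod γ B)⁻¹ʳ) * mprod γ B = U := by
  have hconj (B C : Finset (Fin n)) : (mprod γ B)⁻¹ʳ * (mprod γ C)⁻¹ʳ * mprod γ B =
      mprod γ B * (mprod γ C)⁻¹ʳ * (mprod γ B)⁻¹ʳ := by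
    simp only [hγ.inverse_mprod B, smul_mul_assoc, mul_smul_comm]
  calc _ = ∑ C with Even #C, mprod β C * U * evenAverage K γ γ ((mprod γ C)⁻¹ʳ) := by
        simp only [evenAverage_apply, ← hconj, smul_mul_assoc, mul_smul_comm, mul_sum, sum_mul,
          smul_sum]
        rw [sum_comm]
        simp only [mul_assoc]
    _ = ∑ C with Even #C, mprod β C * U * if ∅ = C then 1 else 0 :=
        sum_congr rfl fun C hC => by
          rw [← evenAverage_mprod_mul_inverse hγ hn (by simp) (mem_filter_univ C |>.1 hC),
            mprod_empty, one_mul]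
    _ = U := by simp

/-- The expansion of the elements of `A` as `∑_{|B| even} T B * γ^B`; the coordinates `T B` are
even intertwiners rather than scalars, which is what makes the expansion unique. -/
noncomputable def evenExpansion (hβ : IsCliffordFamily s β) (hγ : IsCliffordFamily s γ)
    (hn : Odd n) : ({B : Finset (Fin n) // Even #B} → evenIntertwiners K β γ) ≃ₗ[K] A where
  toFun T := ∑ B, (T B : A) * mprod γ B
  map_add' S T := by simp [add_mul, sum_add_distrib]
  map_smul' c T := by simp [smul_sum]
  invFun U B := ⟨evenAverage K β γ (U * (mprod γ B)⁻¹ʳ), evenAverage_mem hβ hγ _⟩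
  left_inv T := by
    ext B
    have hcoord (C : {C : Finset (Fin n) // Even #C}) :
        (T C : A) * evenAverage K γ γ (mprod γ C * (mprod γ B)⁻¹ʳ) =
          if C = B then (T C : A) else 0 := by
      rw [evenAverage_mprod_mul_inverse hγ hn C.2 B.2, mul_ite, mul_one, mul_zero]
      simp only [Subtype.coe_inj]
    simp [sum_mul, mul_assoc, evenAverage_mul (T _).2, hcoord, -mul_ite]
  right_inv U := by
    conv_rhs => rw [← sum_evenAverage_mul_mprod (K := K) (β := β) hγ hn U]
    exact (sum_subtype _ (by simp) fun B =>
      evenAverage K β γ (U * (mprod γ B)⁻¹ʳ) * mprod γ B).symm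

lemma finrank_eq_mul_finrank_evenIntertwiners [FiniteDimensional K A]
    (hβ : IsCliffordFamily s β) (hγ : IsCliffordFamily s γ) (hn : Odd n) :
    Module.finrank K A = 2 ^ (n - 1) * Module.finrank K (evenIntertwiners K β γ) := by
  have : Nonempty (Fin n) := ⟨⟨0, hn.pos⟩⟩
  rw [← (evenExpansion hβ hγ hn).finrank_eq, Module.finrank_pi_fintype, sum_const, card_univ,
    Fintype.card_subtype, card_filter_even_card, Fintype.card_fin, smul_eq_mul]

lemma evenIntertwiners_self_eq_span [FiniteDimensional K A] (hγ : IsCliffordFamily s γ)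
    (hn : Odd n) (hrank : Module.finrank K A = 2 ^ n) {w : A}
    (hw : w ∈ Subalgebra.center K A) (hli : LinearIndependent K ![1, w]) :
    evenIntertwiners K γ γ = Submodule.span K {1, w} := by
  have hle : Submodule.span K {1, w} ≤ evenIntertwiners K γ γ := by
    refine Submodule.span_le.2 (Set.pair_subset ?_ ?_) <;> apply center_le_evenIntertwiners
    exacts [one_mem (Subalgebra.center K A), hw]
  have hdim := finrank_eq_mul_finrank_evenIntertwiners (K := K) hγ hγ hn
  have hpow : 2 ^ n = 2 ^ (n - 1) * 2 := by rw [← pow_succ, Nat.sub_add_cancel hn.pos]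
  rw [hrank, hpow] at hdim
  refine (Submodule.eq_of_le_of_finrank_eq hle ?_).symm
  rw [← Nat.eq_of_mul_eq_mul_left (by positivity) hdim, ← Matrix.range_cons_cons_empty _ _ ![],
    finrank_span_eq_card hli, Fintype.card_fin]

lemma span_range_mprod_eq_top (hγ : IsCliffordFamily s γ) (hn : Odd n)
    (hspan : evenIntertwiners K γ γ ≤ Submodule.span K {1, top γ}) :
    Submodule.span K (Set.range (mprod γ)) = ⊤ := by
  have hmem (B : Finset (Fin n)) : mprod γ B ∈ Submodule.span K (Set.range (mprod γ)) :=
    Submodule.subset_span ⟨B, rfl⟩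
  refine Submodule.eq_top_iff'.2 fun U => ?_
  rw [← sum_evenAverage_mul_mprod (K := K) (β := γ) hγ hn U]
  refine Submodule.sum_mem _ fun B _ => ?_
  obtain ⟨a, b, hab⟩ := Submodule.mem_span_pair.1 (hspan (evenAverage_mem hγ hγ _))
  obtain ⟨c, hc⟩ := exists_mprod_mul_mprod (A := A) s univ B
  rw [← hab, add_mul, smul_one_mul, smul_mul_assoc, top, hc γ hγ]
  exact add_mem (Submodule.smul_mem _ _ (hmem _))
    (Submodule.smul_mem _ _ (Submodule.smul_mem _ (c : K) (hmem _)))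

end Averaging

/-- A nonzero central element `e` on whose multiples the center of `A` acts through scalars; for
an idempotent `e` this says that `e` cuts out a block with trivial center. -/
structure IsMinimalCentral (K : Type*) {A : Type*} [Field K] [Ring A] [Algebra K A] (e : A) :
    Prop where
  mem_center : e ∈ Subalgebra.center K A
  ne_zero : e ≠ 0
  exists_smul {z : A} (hz : z ∈ Subalgebra.center K A) : ∃ c : K, e * z = c • e

section InvertibleIntertwiners

variable {K A : Type*} [Field K] [NeZero (2 : K)] [Ring A] [Algebra K A] {n : ℕ}
  {s : Fin n → Kˣ} {β γ : Fin n → A} {e f : A}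

lemma IsMinimalCentral.exists_mul_eq (he : IsMinimalCentral K e) (hβ : IsCliffordFamily s β)
    (hγ : IsCliffordFamily s γ) (hn : Odd n)
    (hcenter : evenIntertwiners K β β ≤ (Subalgebra.center K A).toSubmodule) {T : A}
    (hT : T ∈ evenIntertwiners K β γ) (heT : e * T ≠ 0) : ∃ S, T * S = e := by
  have hsum : ∑ B with Even #B, e * (T * evenAverage K γ β ((mprod β B)⁻¹ʳ)) * mprod β B ≠ 0 := by
    have hone := sum_evenAverage_mul_mprod (K := K) (β := γ) hβ hn 1
    simp only [one_mul] at hone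
    simpa only [mul_assoc, ← mul_sum, hone, mul_one] using heT
  obtain ⟨B, -, hB⟩ := exists_ne_zero_of_sum_ne_zero hsum
  obtain ⟨c, hc⟩ := he.exists_smul
    (hcenter (mul_mem_evenIntertwiners hT (evenAverage_mem hγ hβ (mprod β B)⁻¹ʳ)))
  have hc0 : c ≠ 0 := by
    rintro rfl
    simp [hc] at hB
  refine ⟨c⁻¹ • (e * evenAverage K γ β (mprod β B)⁻¹ʳ), ?_⟩
  rw [mul_smul_comm, ← mul_assoc, Subalgebra.mem_center_iff.1 he.mem_center T, mul_assoc, hc,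
    inv_smul_smul₀ hc0]

lemma IsMinimalCentral.exists_mul_evenAverage_ne_zero (he : IsMinimalCentral K e)
    (hγ : IsCliffordFamily s γ) (hn : Odd n) :
    ∃ B : Finset (Fin n), Even #B ∧ e * evenAverage K β γ (mprod γ B) ≠ 0 := by
  have hsum := sum_evenAverage_mul_mprod (K := K) (β := β) hγ hn e
  obtain ⟨B, hB, hne⟩ := exists_ne_zero_of_sum_ne_zero (hsum.trans_ne he.ne_zero)
  refine ⟨B, mem_filter_univ B |>.1 hB, fun h0 => hne ?_⟩
  rw [evenAverage_mul (center_le_evenIntertwiners he.mem_center), hγ.inverse_mprod,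
    Units.smul_def, map_smul, mul_smul_comm, h0, smul_zero, zero_mul]

lemma exists_isUnit_evenAverage [IsDedekindFiniteMonoid A] (he : IsMinimalCentral K e)
    (hf : IsMinimalCentral K f) (hef : e + f = 1) (hβ : IsCliffordFamily s β)
    (hγ : IsCliffordFamily s γ) (hn : Odd n)
    (hcenter : evenIntertwiners K β β ≤ (Subalgebra.center K A).toSubmodule) :
    ∃ B C : Finset (Fin n), Even #B ∧ Even #C ∧
      IsUnit (evenAverage K β γ (mprod γ B + mprod γ C)) := by
  have hunit {U : A} (heU : e * evenAverage K β γ U ≠ 0) (hfU : f * evenAverage K β γ U ≠ 0) :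
      IsUnit (evenAverage K β γ U) := by
    obtain ⟨S, hS⟩ := he.exists_mul_eq hβ hγ hn hcenter (evenAverage_mem hβ hγ U) heU
    obtain ⟨S', hS'⟩ := hf.exists_mul_eq hβ hγ hn hcenter (evenAverage_mem hβ hγ U) hfU
    exact IsUnit.of_mul_eq_one (S + S') (by rw [mul_add, hS, hS', hef])
  have hdouble {x U : A} (hx : x * evenAverage K β γ U ≠ 0) :
      x * evenAverage K β γ (U + U) ≠ 0 := by
    rw [map_add, mul_add, ← two_smul K]
    exact smul_ne_zero two_ne_zero hx
  obtain ⟨B, hB, heB⟩ := he.exists_mul_evenAverage_ne_zero (β := β) hγ hn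
  obtain ⟨C, hC, hfC⟩ := hf.exists_mul_evenAverage_ne_zero (β := β) hγ hn
  by_cases hfB : f * evenAverage K β γ (mprod γ B) = 0
  · by_cases heC : e * evenAverage K β γ (mprod γ C) = 0
    · refine ⟨B, C, hB, hC, hunit ?_ ?_⟩
      · rwa [map_add, mul_add, heC, add_zero]
      · rwa [map_add, mul_add, hfB, zero_add]
    · exact ⟨C, C, hC, hC, hunit (hdouble heC) (hdouble hfC)⟩
  · exact ⟨B, B, hB, hB, hunit (hdouble heB) (hdouble hfB)⟩

end InvertibleIntertwiners

lemma not_linearIndependent_mprod {K A : Type*} [Ring K] [Nontrivial K] [Ring A] [Module K A]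
    {n : ℕ} (hn : 0 < n) {γ : Fin n → A} {c : K} (h : top γ = c • 1) :
    ¬ LinearIndependent K (mprod γ) := by
  intro hli
  have : Nonempty (Fin n) := ⟨⟨0, hn⟩⟩
  refine hli.notMem_span_image (s := {∅}) (x := univ)
    (by simpa using (univ_nonempty (α := Fin n)).ne_empty) ?_
  rw [Set.image_singleton, mprod_empty, Submodule.mem_span_singleton]
  exact ⟨c, h.symm⟩

section ConstMul

variable {K A : Type*} [CommRing K] [Ring A] [Algebra K A] {n : ℕ} {s : Fin n → Kˣ}
  {β γ : Fin n → A} {c : A} {T : Aˣ}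

lemma mul_self_eq_one_of_semiconjBy (hβ : IsCliffordFamily s β) (hγ : IsCliffordFamily s γ)
    {a : Fin n} (hc : Commute c (β a)) (h : SemiconjBy (T : A) (γ a) (c * β a)) : c * c = 1 := by
  have hsemi := h.mul_right h
  rw [hγ.mul_self, hc.symm.mul_mul_mul_comm, hβ.mul_self, SemiconjBy, mul_smul_comm,
    mul_smul_comm, smul_mul_assoc, mul_one, mul_one] at hsemi
  exact T.isUnit.mul_right_cancel ((one_mul _).trans (smul_left_cancel _ hsemi)).symm

lemma top_eq_and_mem_evenIntertwiners (hn : Odd n) (hc : c ∈ Submonoid.center A)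
    (hsq : c * c = 1) (hT : Commute (T : A) (top γ))
    (h : ∀ a, SemiconjBy (T : A) (γ a) (c * β a)) :
    top β = c * top γ ∧ (T : A) ∈ evenIntertwiners K β γ := by
  have hmprod (B : Finset (Fin n)) : SemiconjBy (T : A) (mprod γ B) (c ^ #B * mprod β B) := by
    rw [← mprod_const_mul hc]
    exact semiconjBy_mprod h B
  have heven {k : ℕ} (hk : Even k) : c ^ k = 1 := by
    obtain ⟨m, rfl⟩ := hk
    rw [← two_mul, pow_mul, pow_two, hsq, one_pow]
  have hpow : c ^ n = c := by
    obtain ⟨m, rfl⟩ := hn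
    rw [pow_succ, heven (even_two_mul m), one_mul]
  have htop : top γ = c * top β := by
    have hsemi := hmprod univ
    rw [card_univ, Fintype.card_fin, hpow] at hsemi
    exact T.isUnit.mul_right_cancel (hT.eq.symm.trans hsemi.eq)
  refine ⟨by rw [htop, ← mul_assoc, hsq, one_mul], fun B hB => ?_⟩
  simpa [heven hB] using hmprod B

lemma semiconjBy_const_mul_of_mem_evenIntertwiners (hβ : IsCliffordFamily s β)
    (hγ : IsCliffordFamily s γ) (hn : Odd n) (hc : c ∈ Submonoid.center A) {T : A}
    (hT : Commute T (top γ)) (htop : top β = c * top γ) (hmem : T ∈ evenIntertwiners K β γ)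
    (a : Fin n) : SemiconjBy T (γ a) (c * β a) := by
  obtain ⟨d, hd⟩ := exists_mul_mprod (A := A) s a univ
  have heven : Even #({a} ∆ univ) := by
    rw [show {a} ∆ univ = ({a} : Finset (Fin n))ᶜ from symmDiff_top _, card_compl,
      Fintype.card_fin, card_singleton]
    exact hn.tsub_odd odd_one
  refine (hγ.isUnit_mprod univ).mul_right_cancel ?_
  calc T * γ a * top γ = d • (T * mprod γ ({a} ∆ univ)) := by
        rw [mul_assoc, top, hd γ hγ, mul_smul_comm]
    _ = β a * top β * T := by
        rw [(hmem _ heven).eq, ← smul_mul_assoc, ← hd β hβ, top]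
    _ = c * β a * (top γ * T) := by
        rw [htop, ← mul_assoc, ← Submonoid.mem_center_iff.1 hc (β a)]
        simp only [mul_assoc]
    _ = c * β a * T * top γ := by rw [← hT.eq, mul_assoc (c * β a)]

end ConstMul

section SquareRoots

variable {K A : Type*} [Field K] [Ring A] [Algebra K A] {w : A} {τ : K}

/-- The idempotent `(1 + τ⁻¹ w) / 2` onto the `τ`-eigenspace of multiplication by `w`, where
`w² = τ² ≠ 0`. -/
def rootIdempotent (τ : K) (w : A) : A := (2 : K)⁻¹ • (1 + τ⁻¹ • w)

lemma rootIdempotent_mul (hτ : τ ≠ 0) (hw : w * w = τ ^ 2 • (1 : A)) :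
    rootIdempotent τ w * w = τ • rootIdempotent τ w := by
  have hcancel : τ⁻¹ * τ ^ 2 = τ := by rw [pow_two, inv_mul_cancel_left₀ hτ]
  rw [rootIdempotent, smul_mul_assoc, smul_comm τ, add_mul, one_mul, smul_mul_assoc, hw,
    smul_smul, hcancel, smul_add τ, smul_inv_smul₀ hτ, add_comm]

variable [NeZero (2 : K)]

lemma rootIdempotent_add_neg (τ : K) (w : A) :
    rootIdempotent τ w + rootIdempotent (-τ) w = 1 := by
  rw [rootIdempotent, rootIdempotent, ← smul_add, inv_smul_eq_iff₀ two_ne_zero, inv_neg]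
  module

lemma isMinimalCentral_rootIdempotent (hτ : τ ≠ 0) (hw : w * w = τ ^ 2 • (1 : A))
    (hli : LinearIndependent K ![1, w])
    (hcenter : (Subalgebra.center K A).toSubmodule = Submodule.span K {1, w}) :
    IsMinimalCentral K (rootIdempotent τ w) where
  mem_center := by
    rw [← Subalgebra.mem_toSubmodule, hcenter, Submodule.mem_span_pair]
    exact ⟨2⁻¹, 2⁻¹ * τ⁻¹, by rw [rootIdempotent, smul_add, smul_smul]⟩
  ne_zero h := by
    rw [rootIdempotent, smul_add, smul_smul] at h
    exact inv_ne_zero two_ne_zero (LinearIndependent.pair_iff.1 hli _ _ h).1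
  exists_smul {z} hz := by
    rw [← Subalgebra.mem_toSubmodule, hcenter, Submodule.mem_span_pair] at hz
    obtain ⟨a, b, rfl⟩ := hz
    exact ⟨a + b * τ, by
      rw [mul_add, mul_smul_comm, mul_one, mul_smul_comm, rootIdempotent_mul hτ hw, add_smul,
        smul_smul]⟩

lemma eq_or_eq_of_mem_span_of_mul_self (hli : LinearIndependent K ![1, w]) (hτ : τ ≠ 0)
    (hw : w * w = τ ^ 2 • (1 : A)) {z : A} (hz : z ∈ Submodule.span K {1, w}) {κ : K}
    (hκ : z * z = κ ^ 2 • (1 : A)) :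
    (z = (κ / τ) • w ∨ z = -((κ / τ) • w)) ∨ (z = κ • (1 : A) ∨ z = -(κ • (1 : A))) := by
  obtain ⟨a, b, rfl⟩ := Submodule.mem_span_pair.1 hz
  have hexpand : (a ^ 2 + b ^ 2 * τ ^ 2) • (1 : A) + (2 * a * b) • w =
      κ ^ 2 • (1 : A) + (0 : K) • w := by
    rw [zero_smul, add_zero, ← hκ]
    simp only [mul_add, add_mul, smul_mul_smul_comm, hw, one_mul, mul_one]
    module
  obtain ⟨hone, hvol⟩ := hli.eq_of_pair hexpand
  rcases mul_eq_zero.1 hvol with h2a | rfl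
  · obtain rfl : a = 0 := (mul_eq_zero.1 h2a).resolve_left two_ne_zero
    have hsq : b ^ 2 = (κ / τ) ^ 2 := by
      field_simp
      linear_combination hone
    left
    rcases sq_eq_sq_iff_eq_or_eq_neg.1 hsq with rfl | rfl <;> simp
  · have hsq : a ^ 2 = κ ^ 2 := by linear_combination hone
    right
    rcases sq_eq_sq_iff_eq_or_eq_neg.1 hsq with rfl | rfl <;> simp

end SquareRoots

section Signature

variable {p q : ℕ}

lemma sig_ne_zero (a : Fin (p + q)) : sig p q a ≠ 0 := by
  rw [sig]
  split_ifs <;> norm_num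

/-- The diagonal entries of `η` as units, the form in which `IsCliffordFamily` takes them. -/
noncomputable def sigUnit (p q : ℕ) (a : Fin (p + q)) : ℂˣ := Units.mk0 (sig p q a) (sig_ne_zero a)

lemma prod_sig : ∏ a, sig p q a = (-1) ^ q := by
  rw [Fin.prod_univ_add]
  simp [sig]

lemma even_choose_two_add_iff {m k : ℕ} : Even ((2 * m + 1).choose 2 + k) ↔ Even (m + k) := by
  have hchoose : (2 * m + 1).choose 2 = m * (2 * m) + m := by
    rw [Nat.choose_two_right, Nat.add_sub_cancel]
    exact Nat.div_eq_of_eq_mul_left two_pos (by ring)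
  simp [hchoose, add_assoc, Nat.even_add]

lemma even_choose_two_add_of_modEq_one (h : (p : ℤ) - (q : ℤ) ≡ 1 [ZMOD 4]) :
    Even ((p + q).choose 2 + q) := by
  obtain ⟨k, hk⟩ := h.symm.dvd
  obtain ⟨m, hm⟩ : ∃ m, p + q = 2 * m + 1 := ⟨(p + q) / 2, by omega⟩
  rw [hm, even_choose_two_add_iff, Nat.even_iff]
  omega

lemma odd_choose_two_add_of_modEq_three (h : (p : ℤ) - (q : ℤ) ≡ 3 [ZMOD 4]) :
    Odd ((p + q).choose 2 + q) := by
  obtain ⟨k, hk⟩ := h.symm.dvd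
  obtain ⟨m, hm⟩ : ∃ m, p + q = 2 * m + 1 := ⟨(p + q) / 2, by omega⟩
  rw [hm, ← Nat.not_even_iff_odd, even_choose_two_add_iff, Nat.even_iff]
  omega

lemma Anticommutes.isCliffordFamily {γ : Fin (p + q) → Cl p q} (h : Anticommutes γ) :
    IsCliffordFamily (sigUnit p q) γ where
  mul_self a := by
    have haa := h a a
    rw [eta, Matrix.diagonal_apply_eq, ← two_smul ℂ, mul_smul] at haa
    exact smul_right_injective _ two_ne_zero haa
  mul_eq_neg {a b} hab := by
    have hsum := h a b
    rw [eta, Matrix.diagonal_apply_ne _ hab, mul_zero, zero_smul] at hsum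
    exact eq_neg_of_add_eq_zero_left hsum

lemma Anticommutes.top_mul_self {γ : Fin (p + q) → Cl p q} (h : Anticommutes γ) :
    top γ * top γ = ((-1) ^ ((p + q).choose 2 + q) : ℂ) • (1 : Cl p q) := by
  have hsq := h.isCliffordFamily.mprod_mul_self univ
  rw [Units.smul_def] at hsq
  simpa [top, sigUnit, Units.coe_prod, prod_sig, pow_add] using hsq

lemma anticommutes_gen : Anticommutes (gen p q) := by
  intro a b
  rw [gen, gen, CliffordAlgebra.ι_mul_ι_add_swap, Algebra.algebraMap_eq_smul_one]
  congr 1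
  rw [QuadraticMap.polar, form]
  simp only [QuadraticMap.weightedSumSquares_apply, ← sum_sub_distrib, Pi.add_apply, eta]
  rw [sum_eq_single a]
  · rcases eq_or_ne a b with rfl | hab
    · simp only [Pi.single_eq_same, Matrix.diagonal_apply_eq, smul_eq_mul]
      ring
    · simp [Matrix.diagonal_apply_ne _ hab, Pi.single_eq_of_ne hab]
  · intro c _ hc
    simp [Pi.single_eq_of_ne hc]
  · simp

end Signature

section Center

variable {p q : ℕ}

lemma finrank_Cl : Module.finrank ℂ (Cl p q) = 2 ^ (p + q) := by
  have : Invertible (2 : ℂ) := invertibleOfNonzero two_ne_zero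
  rw [(CliffordAlgebra.equivExterior (form p q)).finrank_eq,
    Module.finrank_eq_card_basis (Pi.basisFun ℂ (Fin (p + q))).ExteriorAlgebra]
  simp

instance : FiniteDimensional ℂ (Cl p q) :=
  Module.finite_of_finrank_pos (by rw [finrank_Cl]; positivity)

instance : Nontrivial (Cl p q) :=
  Module.nontrivial_of_finrank_pos (R := ℂ) (by rw [finrank_Cl]; positivity)

instance : IsDedekindFiniteMonoid (Cl p q) :=
  have : IsNoetherianRing (Cl p q) := isNoetherian_of_tower ℂ inferInstance
  inferInstance

lemma involute_vol (hn : Odd (p + q)) : CliffordAlgebra.involute (vol p q) = -vol p q := by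
  have hinv := CliffordAlgebra.involute_prod_map_ι (Q := form p q)
    ((univ.sort (· ≤ ·)).map fun a : Fin (p + q) => Pi.single a 1)
  rw [List.map_map, List.length_map, length_sort, card_univ, Fintype.card_fin, hn.neg_one_pow,
    neg_one_smul] at hinv
  exact hinv

lemma linearIndependent_one_vol (hn : Odd (p + q)) :
    LinearIndependent ℂ ![(1 : Cl p q), vol p q] := by
  refine LinearIndependent.pair_iff.2 fun a b h => ?_
  have hinv := congrArg CliffordAlgebra.involute h
  rw [map_add, map_smul, map_smul, involute_vol hn, map_one, map_zero] at hinv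
  have ha : a = 0 := by
    have hsum : (2 * a) • (1 : Cl p q) = 0 := by
      linear_combination (norm := module) h + hinv
    simpa using hsum
  have hvol : vol p q ≠ 0 := (anticommutes_gen.isCliffordFamily.isUnit_mprod univ).ne_zero
  rw [ha, zero_smul, zero_add] at h
  exact ⟨ha, (smul_eq_zero.1 h).resolve_right hvol⟩

lemma vol_mem_center (hn : Odd (p + q)) : vol p q ∈ Subalgebra.center ℂ (Cl p q) := by
  refine Subalgebra.mem_center_iff.2 fun x => ?_
  change Commute x (vol p q)
  induction x using CliffordAlgebra.induction with
  | algebraMap r => exact Algebra.commutes r _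
  | ι v =>
    rw [pi_eq_sum_univ' v, map_sum]
    simp only [map_smul]
    exact Commute.sum_left _ _ _ fun a _ =>
      (anticommutes_gen.isCliffordFamily.commute_top hn a).smul_left _
  | mul a b ha hb => exact ha.mul_left hb
  | add a b ha hb => exact ha.add_left hb

lemma center_eq_span (hn : Odd (p + q)) :
    (Subalgebra.center ℂ (Cl p q)).toSubmodule = Submodule.span ℂ {1, vol p q} := by
  have hone : (1 : Cl p q) ∈ Subalgebra.center ℂ (Cl p q) := one_mem _
  refine le_antisymm ?_ (Submodule.span_le.2 (Set.pair_subset hone (vol_mem_center hn)))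
  exact center_le_evenIntertwiners.trans_eq (evenIntertwiners_self_eq_span
    anticommutes_gen.isCliffordFamily hn finrank_Cl (vol_mem_center hn)
    (linearIndependent_one_vol hn))

variable {γ : Fin (p + q) → Cl p q}

lemma Anticommutes.evenIntertwiners_self (hγ : Anticommutes γ) (hn : Odd (p + q)) :
    evenIntertwiners ℂ γ γ = (Subalgebra.center ℂ (Cl p q)).toSubmodule :=
  (evenIntertwiners_self_eq_span hγ.isCliffordFamily hn finrank_Cl (vol_mem_center hn)
    (linearIndependent_one_vol hn)).trans (center_eq_span hn).symm

lemma Anticommutes.top_mem_center (hγ : Anticommutes γ) (hn : Odd (p + q)) :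
    top γ ∈ Subalgebra.center ℂ (Cl p q) := by
  rw [← Subalgebra.mem_toSubmodule, ← hγ.evenIntertwiners_self hn]
  exact fun B _ => semiconjBy_mprod (fun a => (hγ.isCliffordFamily.commute_top hn a).symm) B

lemma Anticommutes.commute_top (hγ : Anticommutes γ) (hn : Odd (p + q)) (x : Cl p q) :
    Commute x (top γ) :=
  Subalgebra.mem_center_iff.1 (hγ.top_mem_center hn) x

end Center

section TopProduct

variable {p q : ℕ} {β γ : Fin (p + q) → Cl p q} {τ : ℂ}

lemma vol_mul_vol : vol p q * vol p q = ((-1) ^ ((p + q).choose 2 + q) : ℂ) • (1 : Cl p q) :=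
  anticommutes_gen.top_mul_self

lemma vol_mul_vol_of_modEq_one (h : (p : ℤ) - (q : ℤ) ≡ 1 [ZMOD 4]) :
    vol p q * vol p q = (1 : ℂ) ^ 2 • (1 : Cl p q) := by
  rw [vol_mul_vol, (even_choose_two_add_of_modEq_one h).neg_one_pow, one_pow]

lemma vol_mul_vol_of_modEq_three (h : (p : ℤ) - (q : ℤ) ≡ 3 [ZMOD 4]) :
    vol p q * vol p q = Complex.I ^ 2 • (1 : Cl p q) := by
  rw [vol_mul_vol, (odd_choose_two_add_of_modEq_three h).neg_one_pow, Complex.I_sq]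

lemma modEq_one_or_three (hn : Odd (p + q)) :
    (p : ℤ) - (q : ℤ) ≡ 1 [ZMOD 4] ∨ (p : ℤ) - (q : ℤ) ≡ 3 [ZMOD 4] := by
  obtain ⟨m, hm⟩ := hn
  simp only [Int.ModEq]
  omega

lemma eq_or_eq_of_mem_center_of_mul_self (hn : Odd (p + q)) (hτ : τ ≠ 0)
    (hvol : vol p q * vol p q = τ ^ 2 • (1 : Cl p q)) {z : Cl p q}
    (hz : z ∈ Subalgebra.center ℂ (Cl p q)) {κ : ℂ} (hκ : z * z = κ ^ 2 • (1 : Cl p q)) :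
    (z = (κ / τ) • vol p q ∨ z = -((κ / τ) • vol p q)) ∨
      (z = κ • (1 : Cl p q) ∨ z = -(κ • (1 : Cl p q))) :=
  eq_or_eq_of_mem_span_of_mul_self (linearIndependent_one_vol hn) hτ hvol
    (by rwa [← center_eq_span hn]) hκ

lemma Anticommutes.generatesBasis (hγ : Anticommutes γ) (hn : Odd (p + q))
    (h : top γ = vol p q ∨ top γ = -vol p q) : GeneratesBasis γ := by
  have hmem : vol p q ∈ Submodule.span ℂ {1, top γ} := by
    rcases h with h | h <;> rw [h]
    · exact Submodule.mem_span_of_mem (by simp)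
    · exact neg_mem_iff.1 (Submodule.mem_span_of_mem (by simp))
  have hspan : Submodule.span ℂ (Set.range (mprod γ)) = ⊤ := by
    refine span_range_mprod_eq_top hγ.isCliffordFamily hn ?_
    rw [hγ.evenIntertwiners_self hn, center_eq_span hn]
    exact Submodule.span_le.2 (Set.pair_subset (Submodule.mem_span_of_mem (by simp)) hmem)
  exact ⟨linearIndependent_of_top_le_span_of_card_eq_finrank hspan.ge
    (by rw [finrank_Cl, Fintype.card_finset, Fintype.card_fin]), hspan⟩

lemma Anticommutes.top_eq_vol_or_eq_smul_one (hγ : Anticommutes γ) (hn : Odd (p + q))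
    (hτ : τ ≠ 0) (hvol : vol p q * vol p q = τ ^ 2 • (1 : Cl p q)) :
    ((top γ = vol p q ∨ top γ = -vol p q) ∧ GeneratesBasis γ) ∨
      ((top γ = τ • (1 : Cl p q) ∨ top γ = -(τ • (1 : Cl p q))) ∧ ¬ GeneratesBasis γ) := by
  have hsq : top γ * top γ = τ ^ 2 • (1 : Cl p q) := by
    rw [hγ.top_mul_self, ← vol_mul_vol, hvol]
  have hcases := eq_or_eq_of_mem_center_of_mul_self hn hτ hvol (hγ.top_mem_center hn) hsq
  rw [div_self hτ, one_smul] at hcases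
  refine hcases.imp (fun h => ⟨h, hγ.generatesBasis hn h⟩) fun h => ⟨h, fun hbasis => ?_⟩
  obtain ⟨c, hc⟩ : ∃ c : ℂ, top γ = c • (1 : Cl p q) :=
    h.elim (fun h => ⟨τ, h⟩) fun h => ⟨-τ, by rw [h, neg_smul]⟩
  exact not_linearIndependent_mprod hn.pos hc hbasis.1

lemma Anticommutes.eq_top_mul_inverse_top_iff (hγ : Anticommutes γ) {c : Cl p q} :
    c = top β * (top γ)⁻¹ʳ ↔ top β = c * top γ := by
  have hunit : IsUnit (top γ) := hγ.isCliffordFamily.isUnit_mprod univ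
  rw [Ring.eq_mul_inverse_iff_mul_eq _ _ _ hunit, eq_comm]

lemma top_mul_inverse_top_mul_self (hβ : Anticommutes β) (hγ : Anticommutes γ)
    (hn : Odd (p + q)) :
    top β * (top γ)⁻¹ʳ * (top β * (top γ)⁻¹ʳ) = 1 := by
  have hunit : IsUnit (top γ * top γ) :=
    (hγ.isCliffordFamily.isUnit_mprod univ).mul (hγ.isCliffordFamily.isUnit_mprod univ)
  rw [(hβ.commute_top hn _).mul_mul_mul_comm, ← Ring.mul_inverse_rev' (Commute.refl (top γ)),
    hβ.top_mul_self, ← hγ.top_mul_self, Ring.mul_inverse_cancel _ hunit]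

lemma top_mul_inverse_top_mem_center (hβ : Anticommutes β) (hγ : Anticommutes γ)
    (hn : Odd (p + q)) : top β * (top γ)⁻¹ʳ ∈ Subalgebra.center ℂ (Cl p q) := by
  rw [top, top, hγ.isCliffordFamily.inverse_mprod, Units.smul_def]
  exact mul_mem (hβ.top_mem_center hn) (Subalgebra.smul_mem _ (hγ.top_mem_center hn) _)

lemma top_mul_inverse_top_eq (hβ : Anticommutes β) (hγ : Anticommutes γ) (hn : Odd (p + q))
    (hτ : τ ≠ 0) (hvol : vol p q * vol p q = τ ^ 2 • (1 : Cl p q)) :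
    (top β * (top γ)⁻¹ʳ = τ⁻¹ • vol p q ∨ top β * (top γ)⁻¹ʳ = -(τ⁻¹ • vol p q)) ∨
      (top β * (top γ)⁻¹ʳ = 1 ∨ top β * (top γ)⁻¹ʳ = -1) := by
  have hsq := (top_mul_inverse_top_mul_self hβ hγ hn).trans (one_smul ℂ 1).symm
  rw [← one_pow 2] at hsq
  simpa using eq_or_eq_of_mem_center_of_mul_self hn hτ hvol
    (top_mul_inverse_top_mem_center hβ hγ hn) hsq

end TopProduct

section Factors

variable {p q : ℕ} {β γ : Fin (p + q) → Cl p q}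

lemma factor_mem_center (hn : Odd (p + q)) (k : Fin 6) :
    factor p q k ∈ Subalgebra.center ℂ (Cl p q) := by
  have hvol := vol_mem_center hn
  have hsmul := Subalgebra.smul_mem _ hvol Complex.I
  fin_cases k
  exacts [one_mem _, neg_mem (one_mem _), hvol, neg_mem hvol, hsmul, neg_mem hsmul]

/-- The coordinates of the six factors with respect to `1` and `e^{1…n}`. -/
noncomputable def factorCoord : Fin 6 → ℂ × ℂ :=
  ![(1, 0), (-1, 0), (0, 1), (0, -1), (0, Complex.I), (0, -Complex.I)]

lemma factor_eq (k : Fin 6) :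
    factor p q k = (factorCoord k).1 • (1 : Cl p q) + (factorCoord k).2 • vol p q := by
  fin_cases k <;> simp [factor, factorCoord]

lemma factorCoord_injective : Function.Injective factorCoord := by
  intro i j hij
  fin_cases i <;> fin_cases j <;> simp [factorCoord, Complex.ext_iff] at hij ⊢ <;> norm_num at hij

lemma factor_injective (hn : Odd (p + q)) : Function.Injective (factor p q) := by
  intro i j hij
  rw [factor_eq, factor_eq] at hij
  exact factorCoord_injective (Prod.ext_iff.2 ((linearIndependent_one_vol hn).eq_of_pair hij))

lemma exists_factor_of_modEq_one (hβ : Anticommutes β) (hγ : Anticommutes γ)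
    (h : (p : ℤ) - (q : ℤ) ≡ 1 [ZMOD 4]) (hn : Odd (p + q)) :
    ∃ k ∈ ({0, 1, 2, 3} : Set (Fin 6)), top β = factor p q k * top γ := by
  simp only [← hγ.eq_top_mul_inverse_top_iff]
  rcases top_mul_inverse_top_eq hβ hγ hn one_ne_zero (vol_mul_vol_of_modEq_one h) with
    (h | h) | (h | h)
  exacts [⟨2, by simp, by simp [h, factor]⟩, ⟨3, by simp, by simp [h, factor]⟩,
    ⟨0, by simp, by simp [h, factor]⟩, ⟨1, by simp, by simp [h, factor]⟩]

lemma exists_factor_of_modEq_three (hβ : Anticommutes β) (hγ : Anticommutes γ)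
    (h : (p : ℤ) - (q : ℤ) ≡ 3 [ZMOD 4]) (hn : Odd (p + q)) :
    ∃ k ∈ ({0, 1, 4, 5} : Set (Fin 6)), top β = factor p q k * top γ := by
  simp only [← hγ.eq_top_mul_inverse_top_iff]
  rcases top_mul_inverse_top_eq hβ hγ hn Complex.I_ne_zero (vol_mul_vol_of_modEq_three h) with
    (h | h) | (h | h)
  exacts [⟨5, by simp, by simp [h, factor]⟩, ⟨4, by simp, by simp [h, factor]⟩,
    ⟨0, by simp, by simp [h, factor]⟩, ⟨1, by simp, by simp [h, factor]⟩]

lemma existsUnique_factor (hβ : Anticommutes β) (hγ : Anticommutes γ) (hn : Odd (p + q)) :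
    ∃! k : Fin 6, top β = factor p q k * top γ := by
  obtain ⟨k, hk⟩ : ∃ k : Fin 6, top β = factor p q k * top γ := by
    rcases modEq_one_or_three hn with h | h
    · exact (exists_factor_of_modEq_one hβ hγ h hn).imp fun _ => And.right
    · exact (exists_factor_of_modEq_three hβ hγ h hn).imp fun _ => And.right
  refine ⟨k, hk, fun j hj => factor_injective hn ?_⟩
  exact (hγ.isCliffordFamily.isUnit_mprod univ).mul_right_cancel (hj.symm.trans hk)

end Factors

section Relations

variable {p q : ℕ} {β γ : Fin (p + q) → Cl p q} {c : Cl p q} {T T' : (Cl p q)ˣ}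

lemma rel_iff_semiconjBy (hc : c ∈ Subalgebra.center ℂ (Cl p q)) :
    Rel β γ c T ↔ ∀ a, SemiconjBy (T : Cl p q) (γ a) (c * β a) := by
  refine forall_congr' fun a => ?_
  have hcomm : (↑T⁻¹ : Cl p q) * c = c * ↑T⁻¹ := Subalgebra.mem_center_iff.1 hc _
  rw [SemiconjBy, ← Units.eq_inv_mul_iff_mul_eq]
  simp only [← mul_assoc, hcomm]

lemma rel_iff (hβ : Anticommutes β) (hγ : Anticommutes γ) (hn : Odd (p + q))
    (hc : c ∈ Subalgebra.center ℂ (Cl p q)) :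
    Rel β γ c T ↔ top β = c * top γ ∧ (T : Cl p q) ∈ evenIntertwiners ℂ β γ := by
  have hcomm (x : Cl p q) : Commute c x := (Subalgebra.mem_center_iff.1 hc x).symm
  have hT := hγ.commute_top hn (T : Cl p q)
  rw [rel_iff_semiconjBy hc]
  constructor
  · intro h
    exact top_eq_and_mem_evenIntertwiners hn hc (mul_self_eq_one_of_semiconjBy hβ.isCliffordFamily
      hγ.isCliffordFamily (hcomm _) (h ⟨0, hn.pos⟩)) hT h
  · rintro ⟨htop, hmem⟩
    exact semiconjBy_const_mul_of_mem_evenIntertwiners hβ.isCliffordFamily hγ.isCliffordFamily hn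
      hc hT htop hmem

lemma Rel.rel_iff_exists_center (hβ : Anticommutes β) (hγ : Anticommutes γ) (hn : Odd (p + q))
    (hc : c ∈ Subalgebra.center ℂ (Cl p q)) (h : Rel β γ c T) :
    Rel β γ c T' ↔
      ∃ z : (Cl p q)ˣ, (z : Cl p q) ∈ Subalgebra.center ℂ (Cl p q) ∧ T' = z * T := by
  obtain ⟨htop, hT⟩ := (rel_iff hβ hγ hn hc).1 h
  simp only [rel_iff hβ hγ hn hc, htop, true_and, ← Subalgebra.mem_toSubmodule,
    ← hβ.evenIntertwiners_self hn]
  constructor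
  · intro hT'
    exact ⟨T' * T⁻¹, mul_mem_evenIntertwiners hT' (units_inv_mem_evenIntertwiners hT), by simp⟩
  · rintro ⟨z, hz, rfl⟩
    exact mul_mem_evenIntertwiners hz hT

lemma exists_rel_iff (hβ : Anticommutes β) (hγ : Anticommutes γ) (hn : Odd (p + q)) :
    (∃ k : Fin 6, Rel β γ (factor p q k) T) ↔ Rel β γ (top β * (top γ)⁻¹ʳ) T := by
  obtain ⟨k, hk, -⟩ := existsUnique_factor hβ hγ hn
  constructor
  · rintro ⟨j, hj⟩
    have htop := ((rel_iff hβ hγ hn (factor_mem_center hn j)).1 hj).1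
    rwa [← hγ.eq_top_mul_inverse_top_iff.2 htop]
  · intro h
    exact ⟨k, by rwa [hγ.eq_top_mul_inverse_top_iff.2 hk]⟩

lemma HEven_eq_evenAverage (U : Cl p q) : HEven β γ U = evenAverage ℂ β γ U :=
  (evenAverage_apply U).symm

lemma exists_isUnit_HEven (hβ : Anticommutes β) (hγ : Anticommutes γ) (hn : Odd (p + q)) :
    ∃ A B : Finset (Fin (p + q)), Even #A ∧ Even #B ∧
      IsUnit (HEven β γ (mprod γ A + mprod γ B)) := by
  obtain ⟨τ, hτ, hvol⟩ : ∃ τ : ℂ, τ ≠ 0 ∧ vol p q * vol p q = τ ^ 2 • (1 : Cl p q) := by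
    rcases modEq_one_or_three hn with h | h
    · exact ⟨1, one_ne_zero, vol_mul_vol_of_modEq_one h⟩
    · exact ⟨Complex.I, Complex.I_ne_zero, vol_mul_vol_of_modEq_three h⟩
  simp only [HEven_eq_evenAverage]
  exact exists_isUnit_evenAverage
    (isMinimalCentral_rootIdempotent hτ hvol (linearIndependent_one_vol hn) (center_eq_span hn))
    (isMinimalCentral_rootIdempotent (neg_ne_zero.2 hτ) (by rwa [neg_sq])
      (linearIndependent_one_vol hn) (center_eq_span hn))
    (rootIdempotent_add_neg τ _) hβ.isCliffordFamily hγ.isCliffordFamily hn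
    (hβ.evenIntertwiners_self hn).le

lemma exists_rel_HEven (hβ : Anticommutes β) (hγ : Anticommutes γ) (hn : Odd (p + q))
    (hc : c ∈ Subalgebra.center ℂ (Cl p q)) (htop : top β = c * top γ) :
    ∃ A B : Finset (Fin (p + q)), Even #A ∧ Even #B ∧
      ∃ T : (Cl p q)ˣ, (T : Cl p q) = HEven β γ (mprod γ A + mprod γ B) ∧ Rel β γ c T := by
  obtain ⟨A, B, hA, hB, T, hT⟩ := exists_isUnit_HEven hβ hγ hn
  refine ⟨A, B, hA, hB, T, hT, (rel_iff hβ hγ hn hc).2 ⟨htop, ?_⟩⟩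
  rw [hT, HEven_eq_evenAverage]
  exact evenAverage_mem hβ.isCliffordFamily hγ.isCliffordFamily _

lemma exists_rel_iff_top_eq (hβ : Anticommutes β) (hγ : Anticommutes γ) (hn : Odd (p + q))
    (hc : c ∈ Subalgebra.center ℂ (Cl p q)) :
    (∃ T : (Cl p q)ˣ, Rel β γ c T) ↔ top β = c * top γ := by
  refine ⟨fun ⟨T, hT⟩ => ((rel_iff hβ hγ hn hc).1 hT).1, fun htop => ?_⟩
  obtain ⟨_, _, _, _, T, -, hT⟩ := exists_rel_HEven hβ hγ hn hc htop
  exact ⟨T, hT⟩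

end Relations

end PauliClifford

open PauliClifford in
theorem theorem18 (p q : ℕ) (hn : Odd (p + q)) (γ β : Fin (p + q) → Cl p q)
    (hγ : Anticommutes γ) (hβ : Anticommutes β) :
    -- signature `p - q ≡ 1 mod 4`: values of the top products, and only cases 1-4 occur
    ((p : ℤ) - (q : ℤ) ≡ 1 [ZMOD 4] →
      (∀ δ ∈ ({γ, β} : Set (Fin (p + q) → Cl p q)),
        ((top δ = vol p q ∨ top δ = -vol p q) ∧ GeneratesBasis δ) ∨
        ((top δ = 1 ∨ top δ = -1) ∧ ¬ GeneratesBasis δ)) ∧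
      ∃ k ∈ ({0, 1, 2, 3} : Set (Fin 6)), top β = factor p q k * top γ) ∧
    -- signature `p - q ≡ 3 mod 4`: values of the top products, and only cases 1, 2, 5, 6 occur
    ((p : ℤ) - (q : ℤ) ≡ 3 [ZMOD 4] →
      (∀ δ ∈ ({γ, β} : Set (Fin (p + q) → Cl p q)),
        ((top δ = vol p q ∨ top δ = -vol p q) ∧ GeneratesBasis δ) ∨
        ((top δ = Complex.I • (1 : Cl p q) ∨ top δ = -(Complex.I • (1 : Cl p q))) ∧
          ¬ GeneratesBasis δ)) ∧
      ∃ k ∈ ({0, 1, 4, 5} : Set (Fin 6)), top β = factor p q k * top γ) ∧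
    -- exactly one of the six cases occurs
    (∃! k : Fin 6, top β = factor p q k * top γ) ∧
    -- the six equivalences
    (∀ k : Fin 6, (∃ T : (Cl p q)ˣ, Rel β γ (factor p q k) T) ↔
      top β = factor p q k * top γ) ∧
    -- `T` is unique exactly up to an invertible element of the center
    (∀ (k : Fin 6) (T T' : (Cl p q)ˣ), Rel β γ (factor p q k) T →
      (Rel β γ (factor p q k) T' ↔
        ∃ z : (Cl p q)ˣ, (z : Cl p q) ∈ Subalgebra.center ℂ (Cl p q) ∧ T' = z * T)) ∧
    -- the unified form of the six relations
    (∀ T : (Cl p q)ˣ, (∃ k : Fin 6, Rel β γ (factor p q k) T) ↔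
      Rel β γ (top β * Ring.inverse (top γ)) T) ∧
    -- `T` can be taken to be `H_Even(γ^A + γ^B)` with `|A|`, `|B|` even
    (∀ k : Fin 6, top β = factor p q k * top γ →
      ∃ A B : Finset (Fin (p + q)), Even A.card ∧ Even B.card ∧
        ∃ T : (Cl p q)ˣ, (T : Cl p q) = HEven β γ (mprod γ A + mprod γ B) ∧
          Rel β γ (factor p q k) T) := by
  have hmem {δ} (hδ : δ ∈ ({γ, β} : Set (Fin (p + q) → Cl p q))) : Anticommutes δ := by
    rcases hδ with rfl | rfl <;> assumption
  refine ⟨fun h => ⟨fun δ hδ => ?_, exists_factor_of_modEq_one hβ hγ h hn⟩,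
    fun h => ⟨fun δ hδ => ?_, exists_factor_of_modEq_three hβ hγ h hn⟩,
    existsUnique_factor hβ hγ hn,
    fun k => exists_rel_iff_top_eq hβ hγ hn (factor_mem_center hn k),
    fun k _ _ hT => hT.rel_iff_exists_center hβ hγ hn (factor_mem_center hn k),
    fun _ => exists_rel_iff hβ hγ hn,
    fun k htop => exists_rel_HEven hβ hγ hn (factor_mem_center hn k) htop⟩
  · simpa using (hmem hδ).top_eq_vol_or_eq_smul_one hn one_ne_zero (vol_mul_vol_of_modEq_one h)
  · exact (hmem hδ).top_eq_vol_or_eq_smul_one hn Complex.I_ne_zero (vol_mul_vol_of_modEq_three h)
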